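/- Let $n_1,n_2\ge 0$ and $m\ge n_1+n_2+2$ be integers, let $x_1,\dots,x_m\in\mathbb C$ be distinct nodes and $f_1,\dots,f_m\in\mathbb C$. Let $\mathbb P_n$ be the space of complex polynomials of degree at most $n$, let $\psi_0,\dots,\psi_{n_1}$ and $\phi_0,\dots,\phi_{n_2}$ be bases of $\mathbb P_{n_1}$ and $\mathbb P_{n_2}$, and put $\Psi=[\psi_{i}(x_j)]\in\mathbb C^{m\times(n_1+1)}$, $\Phi=[\phi_i(x_j)]\in\mathbb C^{m\times(n_2+1)}$ (the row index is $j$), $F=\mathrm{diag}(f_1,\dots,f_m)$. Let $\mathscr R_{(n_1,n_2)}=\{p/q: p\in\mathbb P_{n_1},\ 0\not\equiv q\in\mathbb P_{n_2}\}$; for $\xi\in\mathscr R_{(n_1,n_2)}$ let $\|\boldsymbol f-\xi(\boldsymbol x)\|_\infty=\max_j|f_j-\xi(x_j)|$, understood as $\infty$ if $\xi$ has a pole at a node. A minimizer of this error over $\mathscr R_{(n_1,n_2)}$ is called a (rational) minimax approximant. For $\boldsymbol w$ in the probability simplex $\mathcal S=\{\boldsymbol w\in\mathbb R^m: w_j\ge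 0,\ \sum_j w_j=1\}$ let $W=\mathrm{diag}(\boldsymbol w)$ and $$d_2(\boldsymbol w)=\min\Big\{\sum_{j=1}^m w_j|f_jq_j-p_j|^2:\ \boldsymbol p=\Psi\boldsymbol a,\ \boldsymbol q=\Phi\boldsymbol b,\ \boldsymbol a\in\mathbb C^{n_1+1},\ \boldsymbol b\in\mathbb C^{n_2+1},\ \sum_{j=1}^m w_j|q_j|^2=1\Big\},$$ $$A_{\boldsymbol w}=[-\Psi,F\Phi]^{\rm H}W[-\Psi,F\Phi],\qquad B_{\boldsymbol w}=[0,\Phi]^{\rm H}W[0,\Phi].$$ Fix $\boldsymbol w=\boldsymbol w^{(k)}\in\mathcal S$ and let $(\boldsymbol a,\boldsymbol b)$ attain the minimum $d_2(\boldsymbol w^{(k)})$; put $\boldsymbol p=\Psi\boldsymbol a$, $\boldsymbol q=\Phi\boldsymbol b$, $\xi^{(k)}=p/q$ with $p=\sum_i a_i\psi_i$ and $q=\sum_i b_i\phi_i$. Let $\mathcal I=\{j: w^{(k)}_j\ne0\}$. Assume that * $d_2(\boldsymbol w^{(k)})$ is a simple eigenvalue of the pencil $(A_{\boldsymbol w^{(k)}},B_{\boldsymbol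 w^{(k)}})$, that is, a simple root of the polynomial $\lambda\mapsto\det(A_{\boldsymbol w^{(k)}}-\lambda B_{\boldsymbol w^{(k)}})$; * (A1) $q_j=q(x_j)\neq0$ for all $j=1,\dots,m$; * (A2) $|\mathcal I|\ge\max\{n_1+1,n_2+1\}$; * $r_j:=|f_j-\xi^{(k)}(x_j)|>0$ for every $j\in\mathcal I$. For $\beta>0$ let $\boldsymbol w^{(k+1)}=\boldsymbol w^{(k+1)}(\beta)$ be the result of one step of d-Lawson, $$w^{(k+1)}_j=\frac{w^{(k)}_j r_j^{\beta}}{\sum_{i=1}^m w^{(k)}_i r_i^{\beta}},\qquad j=1,\dots,m,$$ and let $c=\sqrt{d_2(\boldsymbol w^{(k)})}$. Then: (i) There is $\beta_0>0$ such that $d_2(\boldsymbol w^{(k+1)})\ge d_2(\boldsymbol w^{(k)})$ for every $\beta\in(0,\beta_0)$. (ii) $c\le\|\boldsymbol f-\xi^{(k)}(\boldsymbol x)\|_\infty$, and for all sufficiently small $\beta>0$, $$d_2(\boldsymbol w^{(k+1)})=d_2(\boldsymbol w^{(k)})\ \Longrightarrow\ w^{(k)}_j r_j\,(r_j-c)=0\quad\text{for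 all }1\le j\le m.$$ (iii) For all sufficiently small $\beta>0$: if $d_2(\boldsymbol w^{(k+1)})=d_2(\boldsymbol w^{(k)})$ and, in addition, $c\ge r_j$ for all $j\notin\mathcal I$ and $\xi^{(k)}=p/q$ is irreducible ($p$ and $q$ are coprime), then $\xi^{(k)}$ is a minimax approximant, i.e. it minimizes $\|\boldsymbol f-\xi(\boldsymbol x)\|_\infty$ over $\xi\in\mathscr R_{(n_1,n_2)}$. -/

import Mathlib

open Polynomial

noncomputable section

namespace DLawson

variable {m : ℕ}

/-- The space of complex polynomials of degree at most `n`. -/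
abbrev PolySpace (n : ℕ) : Submodule ℂ ℂ[X] := degreeLE ℂ (n : WithBot ℕ)

/-- The `m × (n+1)` basis matrix with entries `ψ_i (x_j)` (row `j`, column `i`). -/
def basisMatrix {n : ℕ} (ψ : Module.Basis (Fin (n + 1)) ℂ (PolySpace n)) (x : Fin m → ℂ) :
    Matrix (Fin m) (Fin (n + 1)) ℂ :=
  Matrix.of fun j i => (ψ i : ℂ[X]).eval (x j)

/-- The polynomial with coefficient vector `a` in the basis `ψ`. -/
def toPoly {n : ℕ} (ψ : Module.Basis (Fin (n + 1)) ℂ (PolySpace n)) (a : Fin (n + 1) → ℂ) :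
    ℂ[X] :=
  ∑ i, a i • (ψ i : ℂ[X])

/-! The rational minimax problem. -/

/-- Rational functions `p / q` with `deg p ≤ n₁`, `deg q ≤ n₂` and `q` not identically zero. -/
def ratSpace (n₁ n₂ : ℕ) : Set (RatFunc ℂ) :=
  {ξ | ∃ p ∈ PolySpace n₁, ∃ q ∈ PolySpace n₂, q ≠ 0 ∧
    ξ = algebraMap ℂ[X] (RatFunc ℂ) p / algebraMap ℂ[X] (RatFunc ℂ) q}

/-- `ξ` has no pole at any of the nodes (`RatFunc.denom` is the denominator in lowest terms). -/
def FiniteAtNodes (x : Fin m → ℂ) (ξ : RatFunc ℂ) : Prop :=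
  ∀ j, ξ.denom.eval (x j) ≠ 0

/-- The vector `ξ(x) = (ξ(x_1), …, ξ(x_m))`. -/
def nodalValues (x : Fin m → ℂ) (ξ : RatFunc ℂ) : Fin m → ℂ :=
  fun j => ξ.eval (RingHom.id ℂ) (x j)

/-- `ξ` attains the minimum of `‖f - ξ(x)‖_∞` over `ratSpace n₁ n₂`. A function with a pole at a
node has infinite error, so it neither attains the minimum nor needs to be compared with.
The norm on `Fin m → ℂ` is the maximum norm. -/
def IsMinimaxApproximant (n₁ n₂ : ℕ) (x f : Fin m → ℂ) (ξ : RatFunc ℂ) : Prop :=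
  ξ ∈ ratSpace n₁ n₂ ∧ FiniteAtNodes x ξ ∧
    ∀ η ∈ ratSpace n₁ n₂, FiniteAtNodes x η →
      ‖f - nodalValues x ξ‖ ≤ ‖f - nodalValues x η‖

/-! The dual function. The matrices `Ψ`, `Φ` are the basis matrices of numerator and
denominator. -/

section Dual

variable {ι κ : Type*} [Fintype ι] [Fintype κ]

/-- `∑ j, w_j |f_j q_j - p_j|²` with `p = Ψ a`, `q = Φ b`. -/
def dualObjective (Ψ : Matrix (Fin m) ι ℂ) (Φ : Matrix (Fin m) κ ℂ) (f : Fin m → ℂ)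
    (w : Fin m → ℝ) (a : ι → ℂ) (b : κ → ℂ) : ℝ :=
  ∑ j, w j * ‖f j * (Φ.mulVec b) j - (Ψ.mulVec a) j‖ ^ 2

/-- The normalization `∑ j, w_j |q_j|² = 1` with `q = Φ b`. -/
def IsNormalized (Φ : Matrix (Fin m) κ ℂ) (w : Fin m → ℝ) (b : κ → ℂ) : Prop :=
  ∑ j, w j * ‖(Φ.mulVec b) j‖ ^ 2 = 1

/-- The dual function `d₂(w)`: the minimum of `dualObjective` over all `(a, b)` with `b`
normalized. -/
def d₂ (Ψ : Matrix (Fin m) ι ℂ) (Φ : Matrix (Fin m) κ ℂ) (f : Fin m → ℂ) (w : Fin m → ℝ) : ℝ :=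
  sInf {t | ∃ (a : ι → ℂ) (b : κ → ℂ), IsNormalized Φ w b ∧ dualObjective Ψ Φ f w a b = t}

/-- `(a, b)` solves the minimization problem that defines `d₂(w)`. -/
def IsDualSolution (Ψ : Matrix (Fin m) ι ℂ) (Φ : Matrix (Fin m) κ ℂ) (f : Fin m → ℂ)
    (w : Fin m → ℝ) (a : ι → ℂ) (b : κ → ℂ) : Prop :=
  IsNormalized Φ w b ∧
    ∀ (a' : ι → ℂ) (b' : κ → ℂ), IsNormalized Φ w b' →
      dualObjective Ψ Φ f w a b ≤ dualObjective Ψ Φ f w a' b'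

/-- `A_w = [-Ψ, FΦ]ᴴ W [-Ψ, FΦ]` with `F = diag f`, `W = diag w`. -/
def pencilA (Ψ : Matrix (Fin m) ι ℂ) (Φ : Matrix (Fin m) κ ℂ) (f : Fin m → ℂ) (w : Fin m → ℝ) :
    Matrix (ι ⊕ κ) (ι ⊕ κ) ℂ :=
  (Matrix.fromCols (-Ψ) (Matrix.diagonal f * Φ)).conjTranspose *
    Matrix.diagonal (fun j => (w j : ℂ)) * Matrix.fromCols (-Ψ) (Matrix.diagonal f * Φ)

/-- `B_w = [0, Φ]ᴴ W [0, Φ]`. -/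
def pencilB (ι : Type*) [Fintype ι] (Φ : Matrix (Fin m) κ ℂ) (w : Fin m → ℝ) :
    Matrix (ι ⊕ κ) (ι ⊕ κ) ℂ :=
  (Matrix.fromCols (0 : Matrix (Fin m) ι ℂ) Φ).conjTranspose *
    Matrix.diagonal (fun j => (w j : ℂ)) * Matrix.fromCols (0 : Matrix (Fin m) ι ℂ) Φ

/-- `μ` is a simple eigenvalue of the matrix pencil `(A, B)`: a root of multiplicity one of the
characteristic polynomial `det (A - X B)`. -/
def IsSimpleEigenvalue [DecidableEq ι] (A B : Matrix ι ι ℂ) (μ : ℂ) : Prop :=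
  (Matrix.det (A.map C - (X : ℂ[X]) • B.map C)).rootMultiplicity μ = 1

/-- The vector `ξ(x) = (Ψ a) ./ (Φ b)` (meaningful when `Φ b` has no zero entry). -/
def approxVec (Ψ : Matrix (Fin m) ι ℂ) (Φ : Matrix (Fin m) κ ℂ) (a : ι → ℂ) (b : κ → ℂ) :
    Fin m → ℂ :=
  fun j => (Ψ.mulVec a) j / (Φ.mulVec b) j

end Dual

/-- One weight update of Lawson's iteration with exponent `β` and residual moduli `r`:
`w_j r_j^β / ∑ i, w_i r_i^β`. -/
def lawsonUpdate (β : ℝ) (r w : Fin m → ℝ) : Fin m → ℝ :=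
  fun j => w j * r j ^ β / ∑ i, w i * r i ^ β

/-- The nodes with nonzero weight. -/
def activeSet (w : Fin m → ℝ) : Set (Fin m) := {j | w j ≠ 0}

end DLawson

end

/-!
The Lagrangian `L_w(v) = ∑ j, w_j (|f_j q_j - p_j|² - d |q_j|²)`, with `v = (a, b)` and
`d = d₂(w)`, is the quadratic form of `A_w - d B_w`. Minimality makes it positive semidefinite, and
`v₀ = (a, b)` lies in its kernel. Two independent kernel vectors of `A - d B` would make
`(X - d)²` divide `det (A - X B)`, so for a simple eigenvalue the kernel is the line through `v₀`
(`IsSimpleEigenvalue.exists_eq_smul`).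

As `d₂` does not change when the weights are scaled, the Lawson step may be replaced by
`w_j r_j^β`. Along this path the Lagrangian with fixed `d` has at `v₀` the derivative
`∑ j, w_j |q_j|² log r_j (r_j² - c²)` at `β = 0`. Since `∑ j, w_j |q_j|² (r_j² - c²) = 0`, `log r_j`
may be replaced by `log r_j - log c`, which shows that the derivative is positive unless `r_j = c`
on the whole support of `w` (`sum_mul_log_mul_pos`). If it is positive, a compactness argument on the
unit sphere shows that the Lagrangian becomes positive definite for small `β > 0`
(`eventually_forall_sum_pos`), so that `d₂` strictly increases
(`eventually_d₂_lt_d₂_lawsonUpdate`). Otherwise the step does not change `w`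
(`lawsonUpdate_eq_self`).

So equality for small `β` forces `r_j = c` on the support. If also `r_j ≤ c` off the support, the
error of the approximant is at most `c`, and by weak duality (`IsDualSolution.sqrt_d₂_le_norm`) no
rational function without poles at the nodes has an error below `c`.
-/

namespace DLawson

open Filter Topology
open scoped ComplexOrder

/-! ### Simple eigenvalues of matrix pencils -/

/-- Cramer's rule, as a column operation that needs no inverse. -/
theorem det_updateCol_mulVec {n R : Type*} [Fintype n] [DecidableEq n] [CommRing R]
    (Q : Matrix n n R) (u : n → R) (i : n) :
    (Q.updateCol i (Q.mulVec u)).det = u i * Q.det := by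
  rw [← Matrix.cramer_apply, Matrix.cramer_eq_adjugate_mulVec, Matrix.mulVec_mulVec,
    Matrix.adjugate_mul, Matrix.smul_mulVec, Matrix.one_mulVec, Pi.smul_apply, smul_eq_mul,
    mul_comm]

/-- Over `ℂ[X]`, the pencil sends an eigenvector to a multiple of `X - C μ`. -/
theorem pencil_mulVec_C {n : Type*} [Fintype n] {A B : Matrix n n ℂ} {μ : ℂ} {u : n → ℂ}
    (hu : (A - μ • B).mulVec u = 0) :
    (A.map C - (X : ℂ[X]) • B.map C).mulVec (fun i => C (u i)) =
      (X - C μ) • fun i => C (-(B.mulVec u i)) := by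
  have hA : ∀ i, A.mulVec u i = μ * B.mulVec u i := fun i => by
    have := congrFun hu i
    simpa [Matrix.sub_mulVec, Matrix.smul_mulVec, sub_eq_zero] using this
  have hmap : ∀ (M : Matrix n n ℂ) i,
      (M.map (C : ℂ →+* ℂ[X])).mulVec (fun i => C (u i)) i = C (M.mulVec u i) := fun M i => by
    simp [Matrix.mulVec, dotProduct]
  ext1 i
  simp only [Matrix.sub_mulVec, Matrix.smul_mulVec, Pi.sub_apply, Pi.smul_apply, hmap, hA,
    smul_eq_mul, C_mul, C_neg]
  ring

/-- The eigenvectors of a simple eigenvalue form a line: from a second, independent one, each of two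
columns of `A - X B` could be replaced in the determinant by a multiple of `X - C μ`, so that
`(X - C μ)²` would divide it. -/
theorem IsSimpleEigenvalue.exists_eq_smul {n : Type*} [Fintype n] [DecidableEq n]
    {A B : Matrix n n ℂ} {μ : ℂ} (h : IsSimpleEigenvalue A B μ) {u v : n → ℂ} (hu0 : u ≠ 0)
    (hu : (A - μ • B).mulVec u = 0) (hv : (A - μ • B).mulVec v = 0) :
    ∃ t : ℂ, v = t • u := by
  obtain ⟨i, hi⟩ := Function.ne_iff.mp hu0
  rw [Pi.zero_apply] at hi
  by_contra hne
  push Not at hne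
  -- eliminate the `i`-th coordinate of `v`
  set v' : n → ℂ := v - (v i / u i) • u with hv'
  have hv'i : v' i = 0 := by simp [hv', hi]
  have hv'0 : v' ≠ 0 := sub_ne_zero.mpr (hne _)
  have hv'k : (A - μ • B).mulVec v' = 0 := by
    rw [hv', Matrix.mulVec_sub, Matrix.mulVec_smul, hu, hv, smul_zero, sub_zero]
  obtain ⟨j, hj⟩ := Function.ne_iff.mp hv'0
  rw [Pi.zero_apply] at hj
  set Q : Matrix n n ℂ[X] := A.map C - (X : ℂ[X]) • B.map C with hQ
  set Q' := Q.updateCol i (fun k => C (-(B.mulVec u k))) with hQ'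
  have h1 : C (u i) * Q.det = (X - C μ) * Q'.det := by
    rw [← det_updateCol_mulVec Q (fun k => C (u k)) i, pencil_mulVec_C hu,
      Matrix.det_updateCol_smul]
  -- `v' i = 0`, so that the changed column does not contribute
  have h2 : Q'.mulVec (fun k => C (v' k)) = Q.mulVec (fun k => C (v' k)) := by
    ext1 k
    refine Finset.sum_congr rfl fun l _ => ?_
    rcases eq_or_ne l i with rfl | hl
    · simp [hv'i]
    · simp [hQ', hl]
  have h3 : C (v' j) * Q'.det =
      (X - C μ) * (Q'.updateCol j (fun k => C (-(B.mulVec v' k)))).det := by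
    rw [← det_updateCol_mulVec Q' (fun k => C (v' k)) j, h2, pencil_mulVec_C hv'k,
      Matrix.det_updateCol_smul]
  have hdvd : (X - C μ) ^ 2 ∣ Q.det := by
    have h4 : C (v' j * u i) * Q.det =
        (X - C μ) ^ 2 * (Q'.updateCol j (fun k => C (-(B.mulVec v' k)))).det := by
      rw [C_mul, mul_assoc, h1, mul_left_comm, h3]
      ring
    have hunit : IsUnit (C (v' j * u i)) := (mul_ne_zero hj hi).isUnit.map C
    exact (hunit.dvd_mul_left).mp ⟨_, h4⟩
  have hQ0 : Q.det ≠ 0 := by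
    intro h0
    have h' : Q.det.rootMultiplicity μ = 1 := h
    rw [h0, rootMultiplicity_zero] at h'
    exact zero_ne_one h'
  have h5 := (le_rootMultiplicity_iff hQ0).mpr hdvd
  have h' : Q.det.rootMultiplicity μ = 1 := h
  omega

/-! ### First-order perturbation over a compact set -/

/-- If a combination of the functions `h_j` is nonnegative on a compact set and its coefficients move
so that it increases to first order at each of its zeros there, then it becomes positive on the whole
set. Near a zero the divided difference of the coefficients, continued to `β = 0` by the derivative,
stays positive, and the tube lemma makes the range of `β` uniform. -/
theorem eventually_forall_sum_pos {ι V : Type*} [Fintype ι] [TopologicalSpace V] {K : Set V}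
    (hK : IsCompact K) {ω : ι → ℝ → ℝ} {ω' : ι → ℝ} (hω : ∀ j, HasDerivAt (ω j) (ω' j) 0)
    {h : ι → V → ℝ} (hh : ∀ j, Continuous (h j))
    (hnonneg : ∀ v ∈ K, 0 ≤ ∑ j, ω j 0 * h j v)
    (hpos : ∀ v ∈ K, ∑ j, ω j 0 * h j v = 0 → 0 < ∑ j, ω' j * h j v) :
    ∀ᶠ β in 𝓝[>] (0 : ℝ), ∀ v ∈ K, 0 < ∑ j, ω j β * h j v := by
  have hcont : ∀ (g : ι → ℝ → ℝ), (∀ j, ContinuousAt (g j) 0) → ∀ v,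
      ContinuousAt (fun z : ℝ × V => ∑ j, g j z.1 * h j z.2) (0, v) := fun g hg v =>
    tendsto_finsetSum _ fun j _ =>
      ((hg j).comp (f := Prod.fst) (x := ((0 : ℝ), v)) continuousAt_fst).mul
        ((hh j).comp continuous_snd).continuousAt
  have key : ∀ᶠ β in 𝓝 (0 : ℝ), ∀ v ∈ K, v ∈ K → 0 < β → 0 < ∑ j, ω j β * h j v := by
    refine hK.eventually_forall_of_forall_eventually fun v hv => ?_
    rcases (hnonneg v hv).lt_or_eq with hlt | heq
    · filter_upwards [(hcont ω (fun j => (hω j).continuousAt) v).eventually (lt_mem_nhds hlt)]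
        with z hz _ _ using hz
    · have hslope : ∀ j, dslope (ω j) 0 0 = ω' j := fun j => by
        rw [dslope_same, (hω j).deriv]
      have hc := hcont (fun j => dslope (ω j) 0)
        (fun j => continuousAt_dslope_same.mpr (hω j).differentiableAt) v
      have hlt : 0 < ∑ j, dslope (ω j) 0 0 * h j v := by
        simpa only [hslope] using hpos v hv heq.symm
      filter_upwards [hc.eventually (lt_mem_nhds hlt)] with z hz hzK hβ
      have hsplit : ∑ j, ω j z.1 * h j z.2 =
          ∑ j, ω j 0 * h j z.2 + z.1 * ∑ j, dslope (ω j) 0 z.1 * h j z.2 := by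
        rw [Finset.mul_sum, ← Finset.sum_add_distrib]
        refine Finset.sum_congr rfl fun j _ => ?_
        have := sub_smul_dslope (ω j) 0 z.1
        rw [sub_zero, smul_eq_mul] at this
        linear_combination (-h j z.2) * this
      rw [hsplit]
      exact add_pos_of_nonneg_of_pos (hnonneg _ hzK) (mul_pos hβ hz)
  filter_upwards [nhdsWithin_le_nhds key, self_mem_nhdsWithin] with β hβ h0 v hv
  exact hβ v hv hv h0

/-! ### The Lagrangian of the dual problem -/

section Gap

variable {m : ℕ} {ι κ : Type*} [Fintype ι] [Fintype κ]

/-- The contribution `|f_j q_j - p_j|² - d |q_j|²` of node `j` to the Lagrangian of the dual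
problem with multiplier `d`, where `p = Ψ a`, `q = Φ b` and `v = (a, b)`. -/
noncomputable def nodeGap (Ψ : Matrix (Fin m) ι ℂ) (Φ : Matrix (Fin m) κ ℂ) (f : Fin m → ℂ) (d : ℝ)
    (j : Fin m) (v : ι ⊕ κ → ℂ) : ℝ :=
  ‖f j * (Φ.mulVec (v ∘ Sum.inr)) j - (Ψ.mulVec (v ∘ Sum.inl)) j‖ ^ 2 -
    d * ‖(Φ.mulVec (v ∘ Sum.inr)) j‖ ^ 2

variable {Ψ : Matrix (Fin m) ι ℂ} {Φ : Matrix (Fin m) κ ℂ} {f : Fin m → ℂ} {w : Fin m → ℝ}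
  {a : ι → ℂ} {b : κ → ℂ} {d : ℝ}

theorem continuous_mulVec_comp {γ τ : Type*} [Fintype γ] (M : Matrix (Fin m) γ ℂ) (s : γ → τ)
    (j : Fin m) : Continuous fun v : τ → ℂ => (M.mulVec (v ∘ s)) j :=
  (continuous_apply j).comp (continuous_const.matrix_mulVec (Pi.continuous_precomp s))

theorem continuous_nodeGap (j : Fin m) : Continuous (nodeGap Ψ Φ f d j) :=
  (((continuous_const.mul (continuous_mulVec_comp Φ Sum.inr j)).sub
    (continuous_mulVec_comp Ψ Sum.inl j)).norm.pow 2).sub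
    (continuous_const.mul ((continuous_mulVec_comp Φ Sum.inr j).norm.pow 2))

theorem nodeGap_smul (t : ℂ) (j : Fin m) (v : ι ⊕ κ → ℂ) :
    nodeGap Ψ Φ f d j (t • v) = ‖t‖ ^ 2 * nodeGap Ψ Φ f d j v := by
  have h1 : (t • v) ∘ Sum.inr = t • (v ∘ Sum.inr) := rfl
  have h2 : (t • v) ∘ Sum.inl = t • (v ∘ Sum.inl) := rfl
  have h3 : ∀ y z : ℂ, f j * (t * y) - t * z = t * (f j * y - z) := fun y z => by ring
  simp only [nodeGap, h1, h2, Matrix.mulVec_smul, Pi.smul_apply, smul_eq_mul, h3, norm_mul,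
    mul_pow]
  ring

theorem sum_mul_nodeGap_smul (w : Fin m → ℝ) (t : ℂ) (v : ι ⊕ κ → ℂ) :
    ∑ j, w j * nodeGap Ψ Φ f d j (t • v) = ‖t‖ ^ 2 * ∑ j, w j * nodeGap Ψ Φ f d j v := by
  rw [Finset.mul_sum]
  exact Finset.sum_congr rfl fun j _ => by rw [nodeGap_smul]; ring

theorem sum_mul_nodeGap (w : Fin m → ℝ) (a : ι → ℂ) (b : κ → ℂ) (d : ℝ) :
    ∑ j, w j * nodeGap Ψ Φ f d j (Sum.elim a b) =
      dualObjective Ψ Φ f w a b - d * ∑ j, w j * ‖(Φ.mulVec b) j‖ ^ 2 := by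
  simp only [nodeGap, Sum.elim_comp_inl, Sum.elim_comp_inr, dualObjective]
  rw [Finset.mul_sum, ← Finset.sum_sub_distrib]
  exact Finset.sum_congr rfl fun j _ => by ring

/-- At `(a, b)` the contribution of node `j` is governed by the residual of `p / q`. -/
theorem nodeGap_elim (j : Fin m) (hb : (Φ.mulVec b) j ≠ 0) :
    nodeGap Ψ Φ f d j (Sum.elim a b) =
      ‖(Φ.mulVec b) j‖ ^ 2 * (‖f j - approxVec Ψ Φ a b j‖ ^ 2 - d) := by
  have : f j * (Φ.mulVec b) j - (Ψ.mulVec a) j =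
      (Φ.mulVec b) j * (f j - approxVec Ψ Φ a b j) := by
    rw [approxVec]; field_simp
  simp only [nodeGap, Sum.elim_comp_inl, Sum.elim_comp_inr, this, norm_mul, mul_pow]
  ring

theorem IsDualSolution.d₂_eq (hab : IsDualSolution Ψ Φ f w a b) :
    d₂ Ψ Φ f w = dualObjective Ψ Φ f w a b :=
  IsLeast.csInf_eq ⟨⟨a, b, hab.1, rfl⟩, by rintro _ ⟨a', b', hb', rfl⟩; exact hab.2 a' b' hb'⟩

theorem IsDualSolution.sum_mul_nodeGap_eq_zero (hab : IsDualSolution Ψ Φ f w a b) :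
    ∑ j, w j * nodeGap Ψ Φ f (d₂ Ψ Φ f w) j (Sum.elim a b) = 0 := by
  have h : ∑ j, w j * ‖(Φ.mulVec b) j‖ ^ 2 = 1 := hab.1
  rw [sum_mul_nodeGap, h, hab.d₂_eq, mul_one, sub_self]

theorem sum_mul_norm_mulVec_smul (w : Fin m → ℝ) (t : ℂ) (b : κ → ℂ) :
    ∑ j, w j * ‖(Φ.mulVec (t • b)) j‖ ^ 2 = ‖t‖ ^ 2 * ∑ j, w j * ‖(Φ.mulVec b) j‖ ^ 2 := by
  rw [Finset.mul_sum]
  refine Finset.sum_congr rfl fun j _ => ?_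
  rw [Matrix.mulVec_smul, Pi.smul_apply, norm_smul, mul_pow]
  ring

theorem exists_isNormalized_smul (hb : 0 < ∑ j, w j * ‖(Φ.mulVec b) j‖ ^ 2) :
    ∃ t : ℂ, t ≠ 0 ∧ IsNormalized Φ w (t • b) := by
  refine ⟨((Real.sqrt (∑ j, w j * ‖(Φ.mulVec b) j‖ ^ 2))⁻¹ : ℝ), ?_, ?_⟩
  · exact_mod_cast (inv_pos.mpr (Real.sqrt_pos.mpr hb)).ne'
  · rw [IsNormalized, sum_mul_norm_mulVec_smul, Complex.norm_real, Real.norm_eq_abs, sq_abs,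
      inv_pow, Real.sq_sqrt hb.le, inv_mul_cancel₀ hb.ne']

omit [Fintype ι] in
theorem IsNormalized.elim_ne_zero (hb : IsNormalized Φ w b) : Sum.elim a b ≠ 0 := by
  intro h
  have hb0 : b = 0 := by
    rw [← Sum.elim_comp_inr a b, h]; rfl
  rw [hb0, IsNormalized, Matrix.mulVec_zero] at hb
  simp at hb

/-- Rescaling a vector `(a', b')` with `∑ w_j |q_j|² > 0` reduces this to the minimality of
`d₂(w)`; if the sum vanishes, only the nonnegative objective is left. -/
theorem IsDualSolution.sum_mul_nodeGap_nonneg (hab : IsDualSolution Ψ Φ f w a b)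
    (hw : ∀ j, 0 ≤ w j) (v : ι ⊕ κ → ℂ) :
    0 ≤ ∑ j, w j * nodeGap Ψ Φ f (d₂ Ψ Φ f w) j v := by
  obtain ⟨a', b', rfl⟩ : ∃ a' b', v = Sum.elim a' b' :=
    ⟨_, _, (Sum.elim_comp_inl_inr v).symm⟩
  have hobj : 0 ≤ dualObjective Ψ Φ f w a' b' :=
    Finset.sum_nonneg fun j _ => mul_nonneg (hw j) (sq_nonneg _)
  have hN : 0 ≤ ∑ j, w j * ‖(Φ.mulVec b') j‖ ^ 2 :=
    Finset.sum_nonneg fun j _ => mul_nonneg (hw j) (sq_nonneg _)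
  rcases hN.eq_or_lt with h0 | hpos
  · rw [sum_mul_nodeGap, ← h0, mul_zero, sub_zero]
    exact hobj
  · obtain ⟨t, ht, hnorm⟩ := exists_isNormalized_smul hpos
    have hle := hab.2 (t • a') (t • b') hnorm
    rw [← hab.d₂_eq] at hle
    have hs := sum_mul_nodeGap (Ψ := Ψ) (Φ := Φ) (f := f) w (t • a') (t • b') (d₂ Ψ Φ f w)
    have helim : Sum.elim (t • a') (t • b') = t • Sum.elim a' b' := by
      ext i; cases i <;> rfl
    have hnorm' : ∑ j, w j * ‖(Φ.mulVec (t • b')) j‖ ^ 2 = 1 := hnorm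
    rw [helim, sum_mul_nodeGap_smul, hnorm', mul_one] at hs
    refine (mul_nonneg_iff_of_pos_left (pow_pos (norm_pos_iff.mpr ht) 2)).mp ?_
    rw [hs]
    linarith

theorem isHermitian_weighted_gram {γ : Type*} (G : Matrix (Fin m) γ ℂ) (w : Fin m → ℝ) :
    (G.conjTranspose * Matrix.diagonal (fun j => (w j : ℂ)) * G).IsHermitian := by
  refine Matrix.isHermitian_conjTranspose_mul_mul G ?_
  rw [Matrix.isHermitian_diagonal_iff]
  exact fun j => by simp [isSelfAdjoint_iff]

theorem star_dotProduct_weighted_gram {γ : Type*} [Fintype γ] (G : Matrix (Fin m) γ ℂ)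
    (w : Fin m → ℝ) (v : γ → ℂ) :
    star v ⬝ᵥ (G.conjTranspose * Matrix.diagonal (fun j => (w j : ℂ)) * G).mulVec v =
      ((∑ j, w j * ‖G.mulVec v j‖ ^ 2 : ℝ) : ℂ) := by
  rw [← Matrix.mulVec_mulVec, ← Matrix.mulVec_mulVec, Matrix.dotProduct_mulVec,
    ← Matrix.star_mulVec]
  simp only [dotProduct, Matrix.mulVec_diagonal, Pi.star_apply, Complex.ofReal_sum,
    Complex.ofReal_mul, Complex.ofReal_pow]
  refine Finset.sum_congr rfl fun j _ => ?_
  rw [mul_left_comm, RCLike.star_def, Complex.conj_mul']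

theorem star_dotProduct_pencil (v : ι ⊕ κ → ℂ) :
    star v ⬝ᵥ (pencilA Ψ Φ f w - (d : ℂ) • pencilB ι Φ w).mulVec v =
      ((∑ j, w j * nodeGap Ψ Φ f d j v : ℝ) : ℂ) := by
  rw [Matrix.sub_mulVec, Matrix.smul_mulVec, dotProduct_sub, dotProduct_smul, pencilA, pencilB,
    star_dotProduct_weighted_gram, star_dotProduct_weighted_gram, smul_eq_mul,
    ← Complex.ofReal_mul, ← Complex.ofReal_sub, Finset.mul_sum, ← Finset.sum_sub_distrib]
  congr 1
  refine Finset.sum_congr rfl fun j _ => ?_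
  have h1 : (Matrix.fromCols (-Ψ) (Matrix.diagonal f * Φ)).mulVec v j =
      f j * (Φ.mulVec (v ∘ Sum.inr)) j - (Ψ.mulVec (v ∘ Sum.inl)) j := by
    rw [Matrix.fromCols_mulVec, Pi.add_apply, Matrix.neg_mulVec, ← Matrix.mulVec_mulVec,
      Matrix.mulVec_diagonal, Pi.neg_apply]
    ring
  have h2 : (Matrix.fromCols (0 : Matrix (Fin m) ι ℂ) Φ).mulVec v j =
      (Φ.mulVec (v ∘ Sum.inr)) j := by
    rw [Matrix.fromCols_mulVec, Matrix.zero_mulVec, zero_add]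
  rw [h1, h2, nodeGap]
  ring

theorem IsDualSolution.posSemidef (hab : IsDualSolution Ψ Φ f w a b) (hw : ∀ j, 0 ≤ w j) :
    (pencilA Ψ Φ f w - (d₂ Ψ Φ f w : ℂ) • pencilB ι Φ w).PosSemidef := by
  refine Matrix.PosSemidef.of_dotProduct_mulVec_nonneg ?_ fun v => ?_
  · refine (isHermitian_weighted_gram _ w).sub ?_
    exact (isHermitian_weighted_gram _ w).smul (Complex.conj_ofReal _)
  · rw [star_dotProduct_pencil]
    exact_mod_cast hab.sum_mul_nodeGap_nonneg hw v

/-- The Lagrangian is positive semidefinite, so its zeros are kernel vectors of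
`A_w - d₂(w) B_w`, and these form a line when the eigenvalue is simple. -/
theorem IsDualSolution.exists_eq_smul [DecidableEq ι] [DecidableEq κ]
    (hab : IsDualSolution Ψ Φ f w a b) (hw : ∀ j, 0 ≤ w j)
    (hsimple : IsSimpleEigenvalue (pencilA Ψ Φ f w) (pencilB ι Φ w) (d₂ Ψ Φ f w : ℂ))
    {v : ι ⊕ κ → ℂ} (hv : ∑ j, w j * nodeGap Ψ Φ f (d₂ Ψ Φ f w) j v = 0) :
    ∃ t : ℂ, v = t • Sum.elim a b := by
  have hker : ∀ u : ι ⊕ κ → ℂ, ∑ j, w j * nodeGap Ψ Φ f (d₂ Ψ Φ f w) j u = 0 →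
      (pencilA Ψ Φ f w - (d₂ Ψ Φ f w : ℂ) • pencilB ι Φ w).mulVec u = 0 := fun u hu => by
    rw [← (hab.posSemidef hw).dotProduct_mulVec_zero_iff, star_dotProduct_pencil, hu,
      Complex.ofReal_zero]
  exact hsimple.exists_eq_smul hab.1.elim_ne_zero (hker _ hab.sum_mul_nodeGap_eq_zero)
    (hker _ hv)

/-- Compactness of the unit sphere turns pointwise positivity of the Lagrangian into a uniform
lower bound `ε ∑ w_j |q_j|²`, hence into the gap `ε` for the infimum. -/
theorem lt_d₂_of_forall_sphere_pos (hw : ∀ j, 0 ≤ w j)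
    (hne : ∃ b : κ → ℂ, IsNormalized Φ w b)
    (hpos : ∀ v ∈ Metric.sphere (0 : ι ⊕ κ → ℂ) 1, 0 < ∑ j, w j * nodeGap Ψ Φ f d j v) :
    d < d₂ Ψ Φ f w := by
  have hQ : ∀ j, Continuous fun v : ι ⊕ κ → ℂ => ‖Φ.mulVec (v ∘ Sum.inr) j‖ ^ 2 := fun j =>
    (continuous_mulVec_comp Φ Sum.inr j).norm.pow 2
  have hQ0 : ∀ v : ι ⊕ κ → ℂ, 0 ≤ ∑ j, w j * ‖Φ.mulVec (v ∘ Sum.inr) j‖ ^ 2 := fun v =>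
    Finset.sum_nonneg fun j _ => mul_nonneg (hw j) (sq_nonneg _)
  obtain ⟨ε, hε, hεle⟩ := (isCompact_sphere (0 : ι ⊕ κ → ℂ) 1).exists_forall_le'
    (f := fun v => (∑ j, w j * nodeGap Ψ Φ f d j v) /
      (∑ j, w j * ‖Φ.mulVec (v ∘ Sum.inr) j‖ ^ 2 + 1)) (a := 0)
    (Continuous.continuousOn <| (continuous_finsetSum _ fun j _ =>
      continuous_const.mul (continuous_nodeGap j)).div
      ((continuous_finsetSum _ fun j _ => continuous_const.mul (hQ j)).add continuous_const)
      fun v => by linarith [hQ0 v])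
    fun v hv => div_pos (hpos v hv) (by linarith [hQ0 v])
  refine (lt_add_of_pos_right d hε).trans_le (le_csInf ?_ ?_)
  · obtain ⟨b, hb⟩ := hne
    exact ⟨_, 0, b, hb, rfl⟩
  · rintro _ ⟨a, b, hb, rfl⟩
    have hv0 : Sum.elim a b ≠ 0 := hb.elim_ne_zero
    set v := Sum.elim a b with hv
    have hvn : ‖v‖ ≠ 0 := norm_ne_zero_iff.mpr hv0
    set u : ι ⊕ κ → ℂ := ((‖v‖⁻¹ : ℝ) : ℂ) • v with hu
    have husphere : u ∈ Metric.sphere (0 : ι ⊕ κ → ℂ) 1 := by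
      rw [mem_sphere_zero_iff_norm, hu, norm_smul, Complex.norm_real, norm_inv, norm_norm,
        inv_mul_cancel₀ hvn]
    have h1 := (le_div_iff₀ (by linarith [hQ0 u])).mp (hεle u husphere)
    have hb' : ∑ j, w j * ‖Φ.mulVec b j‖ ^ 2 = 1 := hb
    have h2 : ∑ j, w j * ‖Φ.mulVec (u ∘ Sum.inr) j‖ ^ 2 = (‖v‖⁻¹) ^ 2 := by
      have hub : u ∘ Sum.inr = ((‖v‖⁻¹ : ℝ) : ℂ) • b := rfl
      rw [hub, sum_mul_norm_mulVec_smul, hb', Complex.norm_real, norm_inv, norm_norm, mul_one]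
    have h3 := sum_mul_nodeGap (Ψ := Ψ) (Φ := Φ) (f := f) w a b d
    rw [h2, hu, sum_mul_nodeGap_smul, Complex.norm_real, norm_inv, norm_norm, h3, hb'] at h1
    have h4 : 0 < (‖v‖⁻¹) ^ 2 := by positivity
    have h5 : ‖v‖⁻¹ ^ 2 * ε ≤ ‖v‖⁻¹ ^ 2 * (dualObjective Ψ Φ f w a b - d * 1) := by linarith
    have h6 := le_of_mul_le_mul_left h5 h4
    linarith

/-- Weak duality: if all residuals of `p' / q'` were below `√d₂(w)`, the Lagrangian would be negative
at `(a', b')`. -/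
theorem IsDualSolution.sqrt_d₂_le_norm (hab : IsDualSolution Ψ Φ f w a b)
    (hw : w ∈ stdSimplex ℝ (Fin m)) (a' : ι → ℂ) {b' : κ → ℂ}
    (hb' : ∀ j, (Φ.mulVec b') j ≠ 0) :
    Real.sqrt (d₂ Ψ Φ f w) ≤ ‖f - approxVec Ψ Φ a' b'‖ := by
  refine Real.sqrt_le_iff.mpr ⟨norm_nonneg _, ?_⟩
  by_contra! hlt
  have hneg : ∀ j, ‖f j - approxVec Ψ Φ a' b' j‖ ^ 2 - d₂ Ψ Φ f w < 0 := fun j => by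
    have h1 : ‖f j - approxVec Ψ Φ a' b' j‖ ≤ ‖f - approxVec Ψ Φ a' b'‖ :=
      norm_le_pi_norm (f - approxVec Ψ Φ a' b') j
    have h2 := pow_le_pow_left₀ (norm_nonneg _) h1 2
    linarith
  have hsum := hab.sum_mul_nodeGap_nonneg hw.1 (Sum.elim a' b')
  obtain ⟨j, -, hj⟩ := Finset.exists_ne_zero_of_sum_ne_zero (hw.2 ▸ one_ne_zero)
  have hgap : ∀ j, nodeGap Ψ Φ f (d₂ Ψ Φ f w) j (Sum.elim a' b') < 0 := fun j => by
    rw [nodeGap_elim j (hb' j)]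
    exact mul_neg_of_pos_of_neg (pow_pos (norm_pos_iff.mpr (hb' j)) 2) (hneg j)
  exact hsum.not_gt <| Finset.sum_neg' (fun j _ => mul_nonpos_of_nonneg_of_nonpos (hw.1 j)
    (hgap j).le) ⟨j, Finset.mem_univ j,
      mul_neg_of_pos_of_neg ((hw.1 j).lt_of_ne' hj) (hgap j)⟩

end Gap

/-! ### The Lawson step -/

section Lawson

variable {m : ℕ} {ι κ : Type*} [Fintype ι] [Fintype κ]

/-- Up to the weighted mean zero of `r² - c²`, each `log r_j` may be replaced by
`log r_j - log c`, which has the sign of `r_j² - c²`. -/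
theorem sum_mul_log_mul_pos {α : Type*} [Fintype α] {u r : α → ℝ} {c : ℝ}
    (hu : ∀ j, 0 ≤ u j) (hr : ∀ j, u j ≠ 0 → 0 < r j) (hc : 0 < c)
    (hzero : ∑ j, u j * (r j ^ 2 - c ^ 2) = 0) (hne : ∃ j, u j ≠ 0 ∧ r j ≠ c) :
    0 < ∑ j, u j * (Real.log (r j) * (r j ^ 2 - c ^ 2)) := by
  have heq : ∑ j, u j * (Real.log (r j) * (r j ^ 2 - c ^ 2)) =
      ∑ j, u j * ((Real.log (r j) - Real.log c) * (r j ^ 2 - c ^ 2)) := by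
    rw [← sub_eq_zero, ← Finset.sum_sub_distrib, ← mul_zero (Real.log c), ← hzero,
      Finset.mul_sum]
    exact Finset.sum_congr rfl fun j _ => by ring
  have hpos : ∀ j, u j ≠ 0 → r j ≠ c →
      0 < u j * ((Real.log (r j) - Real.log c) * (r j ^ 2 - c ^ 2)) := fun j hj hjc => by
    refine mul_pos ((hu j).lt_of_ne' hj) ?_
    rcases lt_or_gt_of_ne hjc with h | h
    · exact mul_pos_of_neg_of_neg (sub_neg.mpr (Real.log_lt_log (hr j hj) h))
        (sub_neg.mpr (pow_lt_pow_left₀ h (hr j hj).le two_ne_zero))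
    · exact mul_pos (sub_pos.mpr (Real.log_lt_log hc h))
        (sub_pos.mpr (pow_lt_pow_left₀ h hc.le two_ne_zero))
  rw [heq]
  obtain ⟨j, hj, hjc⟩ := hne
  refine Finset.sum_pos' (fun i _ => ?_) ⟨j, Finset.mem_univ j, hpos j hj hjc⟩
  by_cases h0 : u i = 0
  · rw [h0, zero_mul]
  · by_cases hic : r i = c
    · rw [hic, sub_self, zero_mul, mul_zero]
    · exact (hpos i h0 hic).le

theorem sum_mul_rpow_pos {w r : Fin m → ℝ} (hw : w ∈ stdSimplex ℝ (Fin m))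
    (hr : ∀ j, w j ≠ 0 → 0 < r j) (β : ℝ) : 0 < ∑ j, w j * r j ^ β := by
  have hterm : ∀ j, w j ≠ 0 → 0 < w j * r j ^ β := fun j hj =>
    mul_pos ((hw.1 j).lt_of_ne' hj) (Real.rpow_pos_of_pos (hr j hj) β)
  obtain ⟨j, -, hj⟩ := Finset.exists_ne_zero_of_sum_ne_zero (hw.2 ▸ one_ne_zero)
  refine Finset.sum_pos' (fun i _ => ?_) ⟨j, Finset.mem_univ j, hterm j hj⟩
  by_cases h0 : w i = 0
  · rw [h0, zero_mul]
  · exact (hterm i h0).le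

theorem lawsonUpdate_mem_stdSimplex {w r : Fin m → ℝ} (hw : w ∈ stdSimplex ℝ (Fin m))
    (hr : ∀ j, w j ≠ 0 → 0 < r j) (β : ℝ) : lawsonUpdate β r w ∈ stdSimplex ℝ (Fin m) := by
  have hS := sum_mul_rpow_pos hw hr β
  refine ⟨fun j => div_nonneg ?_ hS.le, ?_⟩
  · by_cases h0 : w j = 0
    · rw [h0, zero_mul]
    · exact mul_nonneg (hw.1 j) (Real.rpow_nonneg (hr j h0).le β)
  · simp only [lawsonUpdate]
    rw [← Finset.sum_div, div_self hS.ne']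

theorem lawsonUpdate_eq_self {w r : Fin m → ℝ} (hw : w ∈ stdSimplex ℝ (Fin m)) {c : ℝ}
    (hc : 0 < c) (hr : ∀ j, w j ≠ 0 → r j = c) (β : ℝ) : lawsonUpdate β r w = w := by
  have h : ∀ j, w j * r j ^ β = w j * c ^ β := fun j => by
    by_cases h0 : w j = 0
    · rw [h0, zero_mul, zero_mul]
    · rw [hr j h0]
  ext1 j
  rw [lawsonUpdate, Finset.sum_congr rfl fun i _ => h i, h, ← Finset.sum_mul, hw.2, one_mul,
    mul_div_cancel_right₀ _ (Real.rpow_pos_of_pos hc β).ne']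

/-- If the residuals are not all equal to `c` on the support, a small Lawson step increases `d₂`. -/
theorem eventually_d₂_lt_d₂_lawsonUpdate [DecidableEq ι] [DecidableEq κ]
    {Ψ : Matrix (Fin m) ι ℂ} {Φ : Matrix (Fin m) κ ℂ} {f : Fin m → ℂ} {w r : Fin m → ℝ}
    {a : ι → ℂ} {b : κ → ℂ} {c : ℝ} (hw : w ∈ stdSimplex ℝ (Fin m))
    (hab : IsDualSolution Ψ Φ f w a b)
    (hsimple : IsSimpleEigenvalue (pencilA Ψ Φ f w) (pencilB ι Φ w) (d₂ Ψ Φ f w : ℂ))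
    (hb : ∀ j, (Φ.mulVec b) j ≠ 0) (hr : r = fun j => ‖f j - approxVec Ψ Φ a b j‖)
    (hrpos : ∀ j, w j ≠ 0 → 0 < r j) (hc : 0 < c) (hd : d₂ Ψ Φ f w = c ^ 2)
    (hne : ∃ j, w j ≠ 0 ∧ r j ≠ c) :
    ∀ᶠ β in 𝓝[>] (0 : ℝ), d₂ Ψ Φ f w < d₂ Ψ Φ f (lawsonUpdate β r w) := by
  have hgap : ∀ j, nodeGap Ψ Φ f (d₂ Ψ Φ f w) j (Sum.elim a b) =
      ‖(Φ.mulVec b) j‖ ^ 2 * (r j ^ 2 - c ^ 2) := fun j => by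
    rw [nodeGap_elim j (hb j), hr, hd]
  have hω : ∀ j, HasDerivAt (fun β : ℝ => w j * r j ^ β) (w j * Real.log (r j)) 0 := fun j => by
    by_cases h0 : w j = 0
    -- at `r j = 0` the power is not continuous in the exponent, but the weight vanishes
    · simpa [h0] using hasDerivAt_const (0 : ℝ) (0 : ℝ)
    · have := (Real.hasStrictDerivAt_const_rpow (hrpos j h0) 0).hasDerivAt.const_mul (w j)
      rwa [Real.rpow_zero, one_mul] at this
  have hderiv : 0 < ∑ j, w j * Real.log (r j) *
      nodeGap Ψ Φ f (d₂ Ψ Φ f w) j (Sum.elim a b) := by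
    have hzero := hab.sum_mul_nodeGap_eq_zero
    simp only [hgap, ← mul_assoc] at hzero
    convert sum_mul_log_mul_pos (u := fun j => w j * ‖(Φ.mulVec b) j‖ ^ 2)
      (fun j => mul_nonneg (hw.1 j) (sq_nonneg _)) (fun j hj => hrpos j (left_ne_zero_of_mul hj))
      hc hzero ?_ using 2 with j
    · rw [hgap]; ring
    · obtain ⟨j, hj, hjc⟩ := hne
      exact ⟨j, mul_ne_zero hj (pow_ne_zero 2 (norm_ne_zero_iff.mpr (hb j))), hjc⟩
  -- at zeros of the Lagrangian on the sphere, which are multiples of `(a, b)`, it increases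
  have hev := eventually_forall_sum_pos (isCompact_sphere (0 : ι ⊕ κ → ℂ) 1) hω
    (h := nodeGap Ψ Φ f (d₂ Ψ Φ f w)) (fun j => continuous_nodeGap j)
    (fun v _ => by
      simpa only [Real.rpow_zero, mul_one] using hab.sum_mul_nodeGap_nonneg hw.1 v)
    (fun v hv h0 => by
      simp only [Real.rpow_zero, mul_one] at h0
      obtain ⟨t, rfl⟩ := hab.exists_eq_smul hw.1 hsimple h0
      have ht : t ≠ 0 := by
        rintro rfl
        simp at hv
      rw [sum_mul_nodeGap_smul]
      exact mul_pos (pow_pos (norm_pos_iff.mpr ht) 2) hderiv)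
  filter_upwards [hev] with β hβ
  have hS := sum_mul_rpow_pos hw hrpos β
  have hw' := lawsonUpdate_mem_stdSimplex hw hrpos β
  refine lt_d₂_of_forall_sphere_pos hw'.1 ?_ fun v hv => ?_
  · obtain ⟨j, -, hj⟩ := Finset.exists_ne_zero_of_sum_ne_zero (hw'.2 ▸ one_ne_zero)
    obtain ⟨t, -, ht⟩ := exists_isNormalized_smul (Φ := Φ) (w := lawsonUpdate β r w) (b := b)
      (Finset.sum_pos' (fun i _ => mul_nonneg (hw'.1 i) (sq_nonneg _))
        ⟨j, Finset.mem_univ j, mul_pos ((hw'.1 j).lt_of_ne' hj)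
          (pow_pos (norm_pos_iff.mpr (hb j)) 2)⟩)
    exact ⟨_, ht⟩
  · have : ∑ j, lawsonUpdate β r w j * nodeGap Ψ Φ f (d₂ Ψ Φ f w) j v =
        (∑ j, w j * r j ^ β * nodeGap Ψ Φ f (d₂ Ψ Φ f w) j v) / ∑ j, w j * r j ^ β := by
      rw [Finset.sum_div]
      exact Finset.sum_congr rfl fun j _ => by rw [lawsonUpdate]; ring
    rw [this]
    exact div_pos (hβ v hv) hS

end Lawson

/-! ### Rational functions at the nodes -/

section Rational

variable {m : ℕ}

theorem basisMatrix_mulVec {n : ℕ} (ψ : Module.Basis (Fin (n + 1)) ℂ (PolySpace n))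
    (x : Fin m → ℂ) (a : Fin (n + 1) → ℂ) (j : Fin m) :
    (basisMatrix ψ x).mulVec a j = (toPoly ψ a).eval (x j) := by
  simp [basisMatrix, toPoly, Matrix.mulVec, dotProduct, eval_finsetSum, mul_comm]

theorem toPoly_mem {n : ℕ} (ψ : Module.Basis (Fin (n + 1)) ℂ (PolySpace n))
    (a : Fin (n + 1) → ℂ) : toPoly ψ a ∈ PolySpace n :=
  Submodule.sum_mem _ fun i _ => Submodule.smul_mem _ _ (ψ i).2

theorem exists_toPoly_eq {n : ℕ} (ψ : Module.Basis (Fin (n + 1)) ℂ (PolySpace n)) {p : ℂ[X]}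
    (hp : p ∈ PolySpace n) : ∃ a, toPoly ψ a = p := by
  refine ⟨ψ.repr ⟨p, hp⟩, ?_⟩
  have h := congrArg (Submodule.subtype _) (ψ.sum_repr ⟨p, hp⟩)
  rw [map_sum] at h
  exact h

theorem mem_polySpace_of_dvd {n : ℕ} {p p' : ℂ[X]} (hp : p ∈ PolySpace n) (hp0 : p ≠ 0)
    (h : p' ∣ p) : p' ∈ PolySpace n :=
  mem_degreeLE.mpr ((degree_le_of_dvd h hp0).trans (mem_degreeLE.mp hp))

theorem num_mem_denom_mem_of_mem_ratSpace {n₁ n₂ : ℕ} {η : RatFunc ℂ}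
    (hη : η ∈ ratSpace n₁ n₂) : η.num ∈ PolySpace n₁ ∧ η.denom ∈ PolySpace n₂ := by
  obtain ⟨p, hp, q, hq, hq0, rfl⟩ := hη
  refine ⟨?_, mem_polySpace_of_dvd hq hq0 (RatFunc.denom_div_dvd p q)⟩
  rcases eq_or_ne p 0 with rfl | hp0
  · simp
  · exact mem_polySpace_of_dvd hp hp0 (RatFunc.num_div_dvd p hq0)

theorem finiteAtNodes_div {x : Fin m → ℂ} (p : ℂ[X]) {q : ℂ[X]} (hq : ∀ j, q.eval (x j) ≠ 0) :
    FiniteAtNodes x (algebraMap ℂ[X] (RatFunc ℂ) p / algebraMap ℂ[X] (RatFunc ℂ) q) :=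
  fun j h0 => hq j (eval_eq_zero_of_dvd_of_eval_eq_zero (RatFunc.denom_div_dvd p q) h0)

theorem nodalValues_div {x : Fin m → ℂ} (p : ℂ[X]) {q : ℂ[X]} (hq : ∀ j, q.eval (x j) ≠ 0)
    (j : Fin m) :
    nodalValues x (algebraMap ℂ[X] (RatFunc ℂ) p / algebraMap ℂ[X] (RatFunc ℂ) q) j =
      p.eval (x j) / q.eval (x j) := by
  have hq0 : q ≠ 0 := by
    rintro rfl
    exact hq j (eval_zero)
  have hden := finiteAtNodes_div p hq j
  have h := congrArg (eval (x j)) ((RatFunc.num_mul_eq_mul_denom_iff (p := p) hq0).mpr rfl)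
  rw [eval_mul, eval_mul] at h
  exact (div_eq_div_iff hden (hq j)).mpr h

end Rational

/-! ### Optimality of the approximant -/

/-- A competitor without poles at the nodes is represented by its numerator and denominator in
lowest terms, to which weak duality applies. -/
theorem IsDualSolution.isMinimaxApproximant {m n₁ n₂ : ℕ} {x f : Fin m → ℂ}
    {ψ : Module.Basis (Fin (n₁ + 1)) ℂ (PolySpace n₁)}
    {φ : Module.Basis (Fin (n₂ + 1)) ℂ (PolySpace n₂)} {w : Fin m → ℝ}
    {a : Fin (n₁ + 1) → ℂ} {b : Fin (n₂ + 1) → ℂ} (hw : w ∈ stdSimplex ℝ (Fin m))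
    (hab : IsDualSolution (basisMatrix ψ x) (basisMatrix φ x) f w a b)
    (hb : ∀ j, (basisMatrix φ x).mulVec b j ≠ 0)
    (hle : ∀ j, ‖f j - approxVec (basisMatrix ψ x) (basisMatrix φ x) a b j‖ ≤
      Real.sqrt (d₂ (basisMatrix ψ x) (basisMatrix φ x) f w)) :
    IsMinimaxApproximant n₁ n₂ x f
      (algebraMap ℂ[X] (RatFunc ℂ) (toPoly ψ a) / algebraMap ℂ[X] (RatFunc ℂ) (toPoly φ b)) := by
  have hq : ∀ j, (toPoly φ b).eval (x j) ≠ 0 := fun j => basisMatrix_mulVec φ x b j ▸ hb j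
  have hb0 : toPoly φ b ≠ 0 := by
    obtain ⟨j, -, -⟩ := Finset.exists_ne_zero_of_sum_ne_zero (hw.2 ▸ one_ne_zero)
    intro h
    exact hq j (by rw [h, eval_zero])
  refine ⟨⟨_, toPoly_mem ψ a, _, toPoly_mem φ b, hb0, rfl⟩, finiteAtNodes_div _ hq,
    fun η hη hfin => ?_⟩
  obtain ⟨hnum, hden⟩ := num_mem_denom_mem_of_mem_ratSpace hη
  obtain ⟨a', ha'⟩ := exists_toPoly_eq ψ hnum
  obtain ⟨b', hb'⟩ := exists_toPoly_eq φ hden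
  have hb'0 : ∀ j, (basisMatrix φ x).mulVec b' j ≠ 0 := fun j => by
    rw [basisMatrix_mulVec, hb']
    exact hfin j
  have hη' : approxVec (basisMatrix ψ x) (basisMatrix φ x) a' b' = nodalValues x η := by
    ext1 j
    rw [approxVec, basisMatrix_mulVec, basisMatrix_mulVec, ha', hb']
    rfl
  rw [← hη']
  refine le_trans ?_ (hab.sqrt_d₂_le_norm hw a' hb'0)
  refine (pi_norm_le_iff_of_nonneg (Real.sqrt_nonneg _)).mpr fun j => ?_
  rw [Pi.sub_apply, nodalValues_div _ hq, ← basisMatrix_mulVec, ← basisMatrix_mulVec]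
  exact hle j

/-- The minimum is the weighted mean `∑ w_j |q_j|² r_j²`. -/
theorem IsDualSolution.d₂_pos {m : ℕ} {ι κ : Type*} [Fintype ι] [Fintype κ]
    {Ψ : Matrix (Fin m) ι ℂ} {Φ : Matrix (Fin m) κ ℂ} {f : Fin m → ℂ} {w : Fin m → ℝ}
    {a : ι → ℂ} {b : κ → ℂ} (hw : w ∈ stdSimplex ℝ (Fin m))
    (hab : IsDualSolution Ψ Φ f w a b) (hb : ∀ j, (Φ.mulVec b) j ≠ 0)
    (hpos : ∀ j, w j ≠ 0 → 0 < ‖f j - approxVec Ψ Φ a b j‖) : 0 < d₂ Ψ Φ f w := by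
  rw [hab.d₂_eq]
  obtain ⟨j, -, hj⟩ := Finset.exists_ne_zero_of_sum_ne_zero (hw.2 ▸ one_ne_zero)
  refine Finset.sum_pos' (fun i _ => mul_nonneg (hw.1 i) (sq_nonneg _))
    ⟨j, Finset.mem_univ j, mul_pos ((hw.1 j).lt_of_ne' hj) (pow_pos (norm_pos_iff.mpr ?_) 2)⟩
  intro h0
  refine (hpos j hj).ne' ?_
  rw [norm_eq_zero, approxVec, ← sub_eq_zero.mp h0, mul_div_cancel_right₀ _ (hb j), sub_self]

end DLawson

theorem theorem5p2 (m n₁ n₂ : ℕ) (hm : n₁ + n₂ + 2 ≤ m)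
    (x f : Fin m → ℂ) (hx : Function.Injective x)
    (ψ : Module.Basis (Fin (n₁ + 1)) ℂ (DLawson.PolySpace n₁))
    (φ : Module.Basis (Fin (n₂ + 1)) ℂ (DLawson.PolySpace n₂))
    (Ψ : Matrix (Fin m) (Fin (n₁ + 1)) ℂ) (hΨ : Ψ = DLawson.basisMatrix ψ x)
    (Φ : Matrix (Fin m) (Fin (n₂ + 1)) ℂ) (hΦ : Φ = DLawson.basisMatrix φ x)
    -- the current weights and the approximant computed from them
    (w : Fin m → ℝ) (hw : w ∈ stdSimplex ℝ (Fin m))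
    (a : Fin (n₁ + 1) → ℂ) (b : Fin (n₂ + 1) → ℂ)
    (hab : DLawson.IsDualSolution Ψ Φ f w a b)
    (hsimple : DLawson.IsSimpleEigenvalue (DLawson.pencilA Ψ Φ f w)
      (DLawson.pencilB (Fin (n₁ + 1)) Φ w) (DLawson.d₂ Ψ Φ f w : ℂ))
    (hA1 : ∀ j, (Φ.mulVec b) j ≠ 0)
    (hA2 : max (n₁ + 1) (n₂ + 1) ≤ (DLawson.activeSet w).ncard)
    -- the moduli of the residuals and the constant `c`
    (r : Fin m → ℝ) (hr : r = fun j => ‖f j - DLawson.approxVec Ψ Φ a b j‖)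
    (hrpos : ∀ j ∈ DLawson.activeSet w, 0 < r j)
    (c : ℝ) (hc : c = Real.sqrt (DLawson.d₂ Ψ Φ f w)) :
    -- (i) monotonicity
    (∃ β₀ : ℝ, 0 < β₀ ∧ ∀ β ∈ Set.Ioo 0 β₀,
      DLawson.d₂ Ψ Φ f w ≤ DLawson.d₂ Ψ Φ f (DLawson.lawsonUpdate β r w)) ∧
    -- (ii) complementary slackness, and the bound on `c`
    c ≤ ‖f - DLawson.approxVec Ψ Φ a b‖ ∧
    ∃ β₁ : ℝ, 0 < β₁ ∧ ∀ β ∈ Set.Ioo 0 β₁,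
      DLawson.d₂ Ψ Φ f (DLawson.lawsonUpdate β r w) = DLawson.d₂ Ψ Φ f w →
        (∀ j, w j * r j * (r j - c) = 0) ∧
        -- (iii) optimality
        ((∀ j ∉ DLawson.activeSet w, r j ≤ c) →
          IsCoprime (DLawson.toPoly ψ a) (DLawson.toPoly φ b) →
          DLawson.IsMinimaxApproximant n₁ n₂ x f
            (algebraMap (Polynomial ℂ) (RatFunc ℂ) (DLawson.toPoly ψ a) /
              algebraMap (Polynomial ℂ) (RatFunc ℂ) (DLawson.toPoly φ b))) := by
  classical
  subst hΨ hΦ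
  have hrpos' : ∀ j, w j ≠ 0 → 0 < r j := hrpos
  have hd0 : 0 < DLawson.d₂ (DLawson.basisMatrix ψ x) (DLawson.basisMatrix φ x) f w :=
    hab.d₂_pos hw hA1 fun j hj => by simpa only [hr] using hrpos' j hj
  have hc0 : 0 < c := hc ▸ Real.sqrt_pos.mpr hd0
  have hd : DLawson.d₂ (DLawson.basisMatrix ψ x) (DLawson.basisMatrix φ x) f w = c ^ 2 := by
    rw [hc, Real.sq_sqrt hd0.le]
  have hcle := hc ▸ hab.sqrt_d₂_le_norm hw a hA1
  by_cases hall : ∀ j, w j ≠ 0 → r j = c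
  · -- the residuals are equal on the support, and the step leaves the weights unchanged
    refine ⟨⟨1, one_pos, fun β _ => ?_⟩, hcle, 1, one_pos, fun β _ _ => ⟨fun j => ?_, ?_⟩⟩
    · rw [DLawson.lawsonUpdate_eq_self hw hc0 hall]
    · by_cases h0 : w j = 0
      · rw [h0, zero_mul, zero_mul]
      · rw [hall j h0, sub_self, mul_zero]
    · intro hout _
      refine hab.isMinimaxApproximant hw hA1 fun j => ?_
      have hle : r j ≤ c := by
        by_cases h0 : w j = 0
        · exact hout j (not_not.mpr h0)
        · exact (hall j h0).le
      rwa [hr, hc] at hle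
  · push Not at hall
    have hev := DLawson.eventually_d₂_lt_d₂_lawsonUpdate hw hab hsimple hA1 hr hrpos' hc0 hd hall
    obtain ⟨β₀, hβ₀, hsub⟩ := mem_nhdsGT_iff_exists_Ioo_subset.mp hev
    exact ⟨⟨β₀, hβ₀, fun β hβ => (hsub hβ).le⟩, hcle, β₀, hβ₀,
      fun β hβ heq => absurd heq (hsub hβ).ne'⟩
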